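/- \textbf{The calculus.} Fix a set of unitary operators; each operator $\mathbf U$ of arity $n\ge 1$ acts on $\ell^2(\{0,1\}^n)$ and has a symbol $U$. Terms, modulo renaming of bound classical variables, are $$M ::= x \mid r \mid {!M} \mid 0 \mid 1 \mid U \mid \mathsf{new}(M) \mid MM \mid \mathsf{meas}(M) \mid \mathsf{if}\ M\ \mathsf{then}\ M\ \mathsf{else}\ M \mid \langle M_1,\dots,M_n\rangle \mid \lambda\pi.M \mid \lambda{!x}.M \qquad (n\ge 2),$$ where $x$ is a classical variable, $r$ is a quantum variable, and a linear pattern $\pi$ is $x$ or $\langle x_1,\dots,x_n\rangle$ with $n\ge2$. For a finite set $V$ of quantum variables let $\mathcal H(V)=\ell^2(\{0,1\}^V)$. A preconfiguration is a triple $[Q,V,M]$ where $M$ is a term whose quantum variables lie in $V$ and $Q\in\mathcal H(V)$ is zero or has norm $1$. A configuration is a preconfiguration up to bijective renaming of quantum variables; $\mathbf{Conf}$ is the set of configurations. For $r\in V$ and $c\in\{0,1\}$ let $m_{r,c}:\mathcal H(V)\to\mathcal H(V\setminus\{r\})$ be the linear map that sends $\sum_i\alpha_i|r\mapsto0\rangle\otimes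 b_i+\sum_i\beta_i|r\mapsto1\rangle\otimes b_i$ (with $\{b_i\}$ the computational basis of $\mathcal H(V\setminus\{r\})$) to $\sum_i\alpha_ib_i$ if $c=0$ and to $\sum_i\beta_ib_i$ if $c=1$. Put $p_c=\langle Q|m_{r,c}^\dagger m_{r,c}|Q\rangle$, and let $M_{r,c}(Q)$ be $m_{r,c}(Q)/\sqrt{p_c}$ if $p_c\ne0$ and $m_{r,c}(Q)$ if $p_c=0$. The contractions are as follows; each has probability $1$, except measurement, which has probability $p_c$. The rules that do not show the register and the set of variables leave them unchanged. \begin{itemize} \item $(\lambda x.M)N\to M\{N/x\}$; $(\lambda{!x}.M){!N}\to M\{N/x\}$; $(\lambda\langle x_1,\dots,x_n\rangle.M)\langle r_1,\dots,r_n\rangle\to M\{r_1/x_1,\dots,r_n/x_n\}$; \item $\mathsf{if}\ 1\ \mathsf{then}\ M\ \mathsf{else}\ N\to M$; $\mathsf{if}\ 0\ \mathsf{then}\ M\ \mathsf{else}\ N\to N$; \item $[Q,V,U\langle r_1,\dots,r_n\rangle]\to[\mathbf U_{r_1,\dots,r_n}Q,V,\langle r_1,\dots,r_n\rangle]$ for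 $U$ of arity $n$ and distinct $r_i$, where $\mathbf U_{r_1,\dots,r_n}$ applies $\mathbf U$ to the qubits $r_1,\dots,r_n$ ($\langle r_1\rangle$ means $r_1$ if $n=1$); \item $[Q,V,\mathsf{new}(c)]\to[Q\otimes|r\mapsto c\rangle,V\cup\{r\},r]$ with $r\notin V$; \item $[Q,V,\mathsf{meas}(r)]\to[M_{r,c}(Q),V\setminus\{r\},{!c}]$ for $c\in\{0,1\}$; \item $L((\lambda\pi.M)N)\to(\lambda\pi.LM)N$ and $((\lambda\pi.M)N)L\to(\lambda\pi.ML)N$, where the variables of $\pi$ are not free in $L$. \end{itemize} They are closed under all term constructors, except that nothing is reduced under $!$ or in the two branches of a conditional. For $C,D\in\mathbf{Conf}$ write $C\to_{n\mathscr M}D$ if $C$ reduces to $D$ by a step that is not a measurement, and $C\to(p:D,\,q:E)$ if $D$ and $E$ are the results of the two different outcomes of one and the same measurement in $C$, with probabilities $p$ and $q$. $\mathsf{NF}$ is the set of configurations that have no reduction step at all. Let $\delta(C)=0$ if the register of $C$ is $0$, and $\delta(C)=1$ otherwise. \textbf{Probabilistic computations.} A probabilistic computation is a possibly infinite tree; the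 set of these trees is the largest set $\mathscr P$ such that each $P\in\mathscr P$ has one of the forms (1) $[C]$ with $C\in\mathbf{Conf}$; (2) $[C,R]$ where $R\in\mathscr P$ has root $D$ and $C\to_{n\mathscr M}D$; (3) $[(p,q,C),R,S]$ where $R,S\in\mathscr P$ have roots $D,E$ and $C\to(p:D,\,q:E)$. The root of $P$ is $C$ in each case. $P$ is maximal if all its leaves are in $\mathsf{NF}$, that is, $P$ lies in the largest such set when (1) is restricted to $C\in\mathsf{NF}$. For a finite computation $R$ and $D\in\mathsf{NF}$ put $$\mathcal P([C],D)=\begin{cases}\delta(C)&C=D\\0&C\ne D,\end{cases}\qquad\mathcal P([C,R],D)=\mathcal P(R,D),\qquad\mathcal P([(p,q,C),R,S],D)=p\,\mathcal P(R,D)+q\,\mathcal P(S,D).$$ For arbitrary $P$ let $\mathcal P(P,D)=\sup_R\mathcal P(R,D)$ over the finite sub-computations $R$ of $P$, that is, the finite computations obtained from $P$ by replacing subtrees by their roots. \textbf{Mixed computations.} A mixed state is a finitely supported probability distribution $\mathscr M$ on $\mathbf{Conf}$. Write $\mathscr M\Longmapsto\mathscr M'$ if for every $C$ in the support of $\mathscr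 M$ there is a mixed state $\mathscr N_C$ such that $\mathscr M'(D)=\sum_C\mathscr M(C)\,\mathscr N_C(D)$ for all $D$, and for each $C$ one of the following holds: $C\in\mathsf{NF}$ and $\mathscr N_C=\{1:C\}$; or $\mathscr N_C=\{1:D\}$ with $C\to_{n\mathscr M}D$; or $\mathscr N_C=\{p:D,\,q:E\}$ with $C\to(p:D,\,q:E)$. A maximal mixed computation is an infinite sequence $(\mathscr M_j)_{j<\omega}$ with $\mathscr M_j\Longmapsto\mathscr M_{j+1}$ for all $j$. \textbf{Proposition.} Let $(\mathscr M_j)_{j<\omega}$ be a maximal mixed computation and let $C_1,\dots,C_n$ be the distinct configurations on which $\mathscr M_0$ is positive. Then there are maximal probabilistic computations $P_1,\dots,P_n$ with roots $C_1,\dots,C_n$ such that $$\sup_{j<\omega}\mathscr M_j(D)=\sum_{i=1}^n\mathscr M_0(C_i)\,\mathcal P(P_i,D)$$ for every $D\in\mathsf{NF}$ such that the register of $D$ is nonzero or the registers of $C_1,\dots,C_n$ are all nonzero. In particular, if the registers of $C_1,\dots,C_n$ are all nonzero, then the equation holds for every $D\in\mathsf{NF}$. -/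

import Mathlib

universe u

namespace QStar

/-! ## Terms -/

/-- A set of unitary operators, each with its symbol `U : Op` and its arity `rank U + 1 ≥ 1`;
`mat U` is its matrix in the computational basis `{0,1}^(rank U + 1)`. -/
structure GateSet where
  Op : Type u
  rank : Op → ℕ
  mat : (U : Op) → Matrix.unitaryGroup (Fin (rank U + 1) → Bool) ℂ

/-- Linear patterns `x` and `<x₁,…,xₙ>` with `n = k + 2`. -/
inductive LinPat where
  | single : LinPat
  | tuple (k : ℕ) : LinPat

/-- The number of variables that a linear pattern binds. -/
def LinPat.arity : LinPat → ℕ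
  | .single => 1
  | .tuple k => k + 2

/-- Terms modulo renaming of bound classical variables, in de Bruijn form: under `d` binders,
`var i` with `i < d` is bound and `var (d + j)` is the free classical variable `x_j`. In the scope
of `λ<x₁,…,xₙ>`, the variables `x₁,…,xₙ` are the indices `0,…,n-1`. Quantum variables are names
in `ℕ` and are never bound. -/
inductive Term (Op : Type u) : Type u where
  | var (i : ℕ) : Term Op
  | qvar (r : ℕ) : Term Op
  | bang (M : Term Op) : Term Op
  | bool (c : Bool) : Term Op
  | gate (U : Op) : Term Op
  | new (M : Term Op) : Term Op
  | app (M N : Term Op) : Term Op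
  | meas (M : Term Op) : Term Op
  | ite (N M₁ M₂ : Term Op) : Term Op
  | tup {k : ℕ} (M : Fin (k + 2) → Term Op) : Term Op
  | lam (π : LinPat) (M : Term Op) : Term Op
  | lamBang (M : Term Op) : Term Op

namespace Term

variable {Op : Type u}

/-- A renaming of indices, moved under `k` binders. -/
def liftRen (k : ℕ) (ρ : ℕ → ℕ) (i : ℕ) : ℕ := if i < k then i else ρ (i - k) + k

/-- Capture-avoiding renaming of classical variables. -/
def rename : (ℕ → ℕ) → Term Op → Term Op
  | ρ, var i => var (ρ i)
  | _, qvar r => qvar r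
  | ρ, bang M => bang (rename ρ M)
  | _, bool c => bool c
  | _, gate U => gate U
  | ρ, new M => new (rename ρ M)
  | ρ, app M N => app (rename ρ M) (rename ρ N)
  | ρ, meas M => meas (rename ρ M)
  | ρ, ite N M₁ M₂ => ite (rename ρ N) (rename ρ M₁) (rename ρ M₂)
  | ρ, tup M => tup fun i => rename ρ (M i)
  | ρ, lam π M => lam π (rename (liftRen π.arity ρ) M)
  | ρ, lamBang M => lamBang (rename (liftRen 1 ρ) M)

/-- The same term, placed under `k` further binders. -/
def shift (k : ℕ) (M : Term Op) : Term Op := rename (fun i => i + k) M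

/-- A substitution, moved under `k` binders. -/
def liftSub (k : ℕ) (σ : ℕ → Term Op) (i : ℕ) : Term Op :=
  if i < k then var i else shift k (σ (i - k))

/-- Capture-avoiding simultaneous substitution for the classical variables. -/
def subst : (ℕ → Term Op) → Term Op → Term Op
  | σ, var i => σ i
  | _, qvar r => qvar r
  | σ, bang M => bang (subst σ M)
  | _, bool c => bool c
  | _, gate U => gate U
  | σ, new M => new (subst σ M)
  | σ, app M N => app (subst σ M) (subst σ N)
  | σ, meas M => meas (subst σ M)
  | σ, ite N M₁ M₂ => ite (subst σ N) (subst σ M₁) (subst σ M₂)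
  | σ, tup M => tup fun i => subst σ (M i)
  | σ, lam π M => lam π (subst (liftSub π.arity σ) M)
  | σ, lamBang M => lamBang (subst (liftSub 1 σ) M)

/-- `M{N₁/x₁,…,Nₙ/xₙ}` for a body `M` in which `x₁,…,xₙ` are the indices `0,…,n-1`. -/
def inst {n : ℕ} (N : Fin n → Term Op) (M : Term Op) : Term Op :=
  subst (fun i => if h : i < n then N ⟨i, h⟩ else var (i - n)) M

/-- The set of quantum variables that occur in a term. -/
def qvars : Term Op → Set ℕ
  | var _ => ∅
  | qvar r => {r}
  | bang M => qvars M
  | bool _ => ∅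
  | gate _ => ∅
  | new M => qvars M
  | app M N => qvars M ∪ qvars N
  | meas M => qvars M
  | ite N M₁ M₂ => qvars N ∪ qvars M₁ ∪ qvars M₂
  | tup M => ⋃ i, qvars (M i)
  | lam _ M => qvars M
  | lamBang M => qvars M

/-- Renaming of quantum variables. -/
def mapQ (f : ℕ → ℕ) : Term Op → Term Op
  | var i => var i
  | qvar r => qvar (f r)
  | bang M => bang (mapQ f M)
  | bool c => bool c
  | gate U => gate U
  | new M => new (mapQ f M)
  | app M N => app (mapQ f M) (mapQ f N)
  | meas M => meas (mapQ f M)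
  | ite N M₁ M₂ => ite (mapQ f N) (mapQ f M₁) (mapQ f M₂)
  | tup M => tup fun i => mapQ f (M i)
  | lam π M => lam π (mapQ f M)
  | lamBang M => lamBang (mapQ f M)

/-- The term `<r₁,…,rₙ>` with `n = k + 1`; since there are no tuples of length one, it is the
variable `r₁` itself for `n = 1`. -/
def qtuple : {k : ℕ} → (Fin (k + 1) → ℕ) → Term Op
  | 0, r => qvar (r 0)
  | _ + 1, r => tup fun i => qvar (r i)

theorem mapQ_congr {f g : ℕ → ℕ} (M : Term Op) (h : ∀ r ∈ M.qvars, f r = g r) :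
    M.mapQ f = M.mapQ g := by
  induction M with
  | tup M ih =>
    simp only [mapQ, Term.tup.injEq, heq_eq_eq, true_and]
    funext i
    exact ih i fun r hr => h r (Set.mem_iUnion.2 ⟨i, hr⟩)
  | qvar r => simpa [mapQ, qvars] using h
  | _ => simp_all [mapQ, qvars]

theorem mapQ_mapQ (f g : ℕ → ℕ) (M : Term Op) : (M.mapQ f).mapQ g = M.mapQ (g ∘ f) := by
  induction M with
  | tup M ih =>
    simp only [mapQ, Term.tup.injEq, heq_eq_eq, true_and]
    funext i
    exact ih i
  | _ => simp_all [mapQ]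

theorem mapQ_id (M : Term Op) : M.mapQ id = M := by
  induction M with
  | tup M ih =>
    simp only [mapQ, Term.tup.injEq, heq_eq_eq, true_and]
    funext i
    exact ih i
  | _ => simp_all [mapQ]

end Term

/-! ## Quantum registers -/

noncomputable section

/-- The Hilbert space `ℓ²({0,1}^QV)`. -/
abbrev HSpace (QV : Finset ℕ) : Type := EuclideanSpace ℂ (QV → Bool)

/-- A quantum register is zero or normalised. -/
def IsRegister {QV : Finset ℕ} (Q : HSpace QV) : Prop := Q = 0 ∨ ‖Q‖ = 1

/-- The assignment on `QV` that maps `r` to `c` and agrees with `b` elsewhere. -/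
def extendAt {QV : Finset ℕ} (r : ℕ) (c : Bool) (b : QV.erase r → Bool) (s : QV) : Bool :=
  if h : (s : ℕ) = r then c else b ⟨s, Finset.mem_erase.2 ⟨h, s.2⟩⟩

/-- The destructive measurement `∑ᵢ αᵢ |r ↦ 0⟩ ⊗ bᵢ + ∑ᵢ βᵢ |r ↦ 1⟩ ⊗ bᵢ ↦ ∑ᵢ αᵢ bᵢ` for the outcome
`0`, and `∑ᵢ βᵢ bᵢ` for the outcome `1`. -/
def destr {QV : Finset ℕ} (r : ℕ) (c : Bool) : HSpace QV →ₗ[ℂ] HSpace (QV.erase r) where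
  toFun Q := WithLp.toLp 2 fun b => Q (extendAt r c b)
  map_add' _ _ := rfl
  map_smul' _ _ := rfl

/-- The probability `⟨Q| m† m |Q⟩` of the outcome `c` when the qubit `r` is measured. -/
def measProb {QV : Finset ℕ} (r : ℕ) (c : Bool) (Q : HSpace QV) : ℝ :=
  RCLike.re (inner ℂ Q (LinearMap.adjoint (destr r c) (destr r c Q)))

open Classical in
/-- The register after the measurement, normalised if its probability is not `0`. -/
def measured {QV : Finset ℕ} (r : ℕ) (c : Bool) (Q : HSpace QV) : HSpace (QV.erase r) :=
  if measProb r c Q = 0 then destr r c Q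
  else ((1 / Real.sqrt (measProb r c Q) : ℝ) : ℂ) • destr r c Q

/-- `Q ⊗ |r ↦ c⟩`, for `r ∉ QV`. -/
def tensorNew {QV : Finset ℕ} (r : ℕ) (c : Bool) (Q : HSpace QV) : HSpace (insert r QV) :=
  WithLp.toLp 2 fun b =>
    if b ⟨r, Finset.mem_insert_self r QV⟩ = c
    then Q fun s => b ⟨s, Finset.mem_insert_of_mem s.2⟩ else 0

/-- The operator with matrix `A`, applied to the qubits `r₁,…,rₙ` of `Q` (`r` injective) and
extended by the identity on the other qubits. -/
def applyGate {QV : Finset ℕ} {n : ℕ} (A : Matrix (Fin n → Bool) (Fin n → Bool) ℂ)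
    (r : Fin n → QV) (Q : HSpace QV) : HSpace QV :=
  WithLp.toLp 2 fun b => ∑ a : Fin n → Bool, A (fun i => b (r i)) a * Q (Function.extend r a b)

/-! ## Configurations -/

/-- A triple `[Q, QV, M]`. -/
structure Triple (Op : Type u) where
  QV : Finset ℕ
  reg : HSpace QV
  term : Term Op

/-- A preconfiguration. -/
structure Preconf (Op : Type u) extends Triple Op where
  isRegister : IsRegister reg
  qvars_subset : term.qvars ⊆ (QV : Set ℕ)

/-- A bijection between sets of quantum variables as a map on all names. -/
def extendBij {QV RV : Finset ℕ} (θ : QV ≃ RV) (r : ℕ) : ℕ :=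
  if h : r ∈ QV then (θ ⟨r, h⟩ : ℕ) else r

/-- Two preconfigurations are equivalent if a bijection `θ` of their quantum variables carries one
to the other; `θ(Q)` is the vector `b ↦ Q (b ∘ θ)`. -/
def Preconf.Equiv {Op : Type u} (c d : Preconf Op) : Prop :=
  ∃ θ : c.QV ≃ d.QV, (∀ b : d.QV → Bool, d.reg b = c.reg (b ∘ θ)) ∧
    d.term = c.term.mapQ (extendBij θ)

theorem Preconf.equivalence (Op : Type u) : Equivalence (Preconf.Equiv (Op := Op)) where
  refl c := by
    refine ⟨_root_.Equiv.refl _, fun b => rfl, ?_⟩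
    conv_lhs => rw [← c.term.mapQ_id]
    refine Term.mapQ_congr _ fun r hr => ?_
    simp [extendBij]
  symm := by
    rintro c d ⟨θ, hQ, hM⟩
    refine ⟨θ.symm, fun b => ?_, ?_⟩
    · have h : (b ∘ θ.symm) ∘ θ = b := by
        funext s
        simp
      rw [hQ, h]
    · rw [hM, Term.mapQ_mapQ]
      conv_lhs => rw [← c.term.mapQ_id]
      refine Term.mapQ_congr _ fun r hr => ?_
      have h : r ∈ c.QV := c.qvars_subset hr
      simp [extendBij, h]
  trans := by
    rintro c d e ⟨θ, hQ, hM⟩ ⟨η, hR, hN⟩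
    refine ⟨θ.trans η, fun b => ?_, ?_⟩
    · rw [hR, hQ]
      rfl
    · rw [hN, hM, Term.mapQ_mapQ]
      refine Term.mapQ_congr _ fun r hr => ?_
      have h : r ∈ c.QV := c.qvars_subset hr
      simp [extendBij, h]

instance Preconf.setoid (Op : Type u) : Setoid (Preconf Op) :=
  ⟨Preconf.Equiv, Preconf.equivalence Op⟩

/-- Configurations: preconfigurations up to renaming of quantum variables. -/
def Conf (Op : Type u) : Type u := Quotient (Preconf.setoid Op)

/-- The quantum register of a configuration is the zero vector. -/
def Conf.IsZero {Op : Type u} : Conf Op → Prop :=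
  Quotient.lift (fun c => c.reg = 0) (by
    rintro c d ⟨θ, hQ, -⟩
    refine propext ⟨fun h => ?_, fun h => ?_⟩
    · ext b
      rw [hQ, h]
      rfl
    · ext b
      have := hQ (b ∘ θ.symm)
      rw [h] at this
      simpa [Function.comp_assoc] using this.symm)

open Classical in
/-- `δ(C)` is `0` if the quantum register of `C` is `0`, and `1` otherwise. -/
def delta {Op : Type u} (C : Conf Op) : ℝ := if C.IsZero then 0 else 1

/-! ## Reduction -/

/-- The labels of the reduction rules. A measurement is labelled with the measured variable and
with the outcome that was observed. -/
inductive Label where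
  | lbeta | cbeta | qbeta | if1 | if0 | Uq | new | lcm | rcm
  | meas (r : ℕ) (c : Bool)

/-- `α` is not a measurement. -/
def Label.NonMeas : Label → Prop
  | .meas _ _ => False
  | _ => True

/-- `Step α p [Q, QV, M] [R, RV, N]`: the contractions and their closure under the surface contexts
(no reduction under `!` or in the branches of a conditional). -/
inductive Step (G : GateSet.{u}) : Label → ℝ → Triple G.Op → Triple G.Op → Prop
  | lbeta (QV : Finset ℕ) (Q : HSpace QV) (M N : Term G.Op) :
      Step G .lbeta 1 ⟨QV, Q, .app (.lam .single M) N⟩ ⟨QV, Q, M.inst ![N]⟩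
  | cbeta (QV : Finset ℕ) (Q : HSpace QV) (M N : Term G.Op) :
      Step G .cbeta 1 ⟨QV, Q, .app (.lamBang M) (.bang N)⟩ ⟨QV, Q, M.inst ![N]⟩
  | qbeta (QV : Finset ℕ) (Q : HSpace QV) {k : ℕ} (M : Term G.Op) (r : Fin (k + 2) → ℕ) :
      Step G .qbeta 1 ⟨QV, Q, .app (.lam (.tuple k) M) (.tup fun i => .qvar (r i))⟩
        ⟨QV, Q, M.inst fun i => .qvar (r i)⟩
  | if1 (QV : Finset ℕ) (Q : HSpace QV) (M N : Term G.Op) :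
      Step G .if1 1 ⟨QV, Q, .ite (.bool true) M N⟩ ⟨QV, Q, M⟩
  | if0 (QV : Finset ℕ) (Q : HSpace QV) (M N : Term G.Op) :
      Step G .if0 1 ⟨QV, Q, .ite (.bool false) M N⟩ ⟨QV, Q, N⟩
  | Uq (QV : Finset ℕ) (Q : HSpace QV) (U : G.Op) (r : Fin (G.rank U + 1) → QV)
      (hr : Function.Injective r) :
      Step G .Uq 1 ⟨QV, Q, .app (.gate U) (.qtuple fun i => (r i : ℕ))⟩
        ⟨QV, applyGate (G.mat U : Matrix _ _ ℂ) r Q, .qtuple fun i => (r i : ℕ)⟩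
  | meas (QV : Finset ℕ) (Q : HSpace QV) (r : ℕ) (c : Bool) (hr : r ∈ QV) :
      Step G (.meas r c) (measProb r c Q) ⟨QV, Q, .meas (.qvar r)⟩
        ⟨QV.erase r, measured r c Q, .bang (.bool c)⟩
  | new (QV : Finset ℕ) (Q : HSpace QV) (r : ℕ) (c : Bool) (hr : r ∉ QV) :
      Step G .new 1 ⟨QV, Q, .new (.bool c)⟩ ⟨insert r QV, tensorNew r c Q, .qvar r⟩
  | lcm (QV : Finset ℕ) (Q : HSpace QV) (π : LinPat) (L M N : Term G.Op) :
      Step G .lcm 1 ⟨QV, Q, .app L (.app (.lam π M) N)⟩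
        ⟨QV, Q, .app (.lam π (.app (L.shift π.arity) M)) N⟩
  | rcm (QV : Finset ℕ) (Q : HSpace QV) (π : LinPat) (L M N : Term G.Op) :
      Step G .rcm 1 ⟨QV, Q, .app (.app (.lam π M) N) L⟩
        ⟨QV, Q, .app (.lam π (.app M (L.shift π.arity))) N⟩
  | tup {α : Label} {p : ℝ} {QV RV : Finset ℕ} {Q : HSpace QV} {R : HSpace RV} {k : ℕ}
      (M : Fin (k + 2) → Term G.Op) (i : Fin (k + 2)) {N : Term G.Op}
      (h : Step G α p ⟨QV, Q, M i⟩ ⟨RV, R, N⟩) :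
      Step G α p ⟨QV, Q, .tup M⟩ ⟨RV, R, .tup (Function.update M i N)⟩
  | appRight {α : Label} {p : ℝ} {QV RV : Finset ℕ} {Q : HSpace QV} {R : HSpace RV}
      (M : Term G.Op) {N P : Term G.Op} (h : Step G α p ⟨QV, Q, N⟩ ⟨RV, R, P⟩) :
      Step G α p ⟨QV, Q, .app M N⟩ ⟨RV, R, .app M P⟩
  | appLeft {α : Label} {p : ℝ} {QV RV : Finset ℕ} {Q : HSpace QV} {R : HSpace RV}
      {M P : Term G.Op} (N : Term G.Op) (h : Step G α p ⟨QV, Q, M⟩ ⟨RV, R, P⟩) :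
      Step G α p ⟨QV, Q, .app M N⟩ ⟨RV, R, .app P N⟩
  | inNew {α : Label} {p : ℝ} {QV RV : Finset ℕ} {Q : HSpace QV} {R : HSpace RV}
      {M N : Term G.Op} (h : Step G α p ⟨QV, Q, M⟩ ⟨RV, R, N⟩) :
      Step G α p ⟨QV, Q, .new M⟩ ⟨RV, R, .new N⟩
  | inMeas {α : Label} {p : ℝ} {QV RV : Finset ℕ} {Q : HSpace QV} {R : HSpace RV}
      {M N : Term G.Op} (h : Step G α p ⟨QV, Q, M⟩ ⟨RV, R, N⟩) :
      Step G α p ⟨QV, Q, .meas M⟩ ⟨RV, R, .meas N⟩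
  | inIf {α : Label} {p : ℝ} {QV RV : Finset ℕ} {Q : HSpace QV} {R : HSpace RV}
      {M N : Term G.Op} (L P : Term G.Op) (h : Step G α p ⟨QV, Q, M⟩ ⟨RV, R, N⟩) :
      Step G α p ⟨QV, Q, .ite M L P⟩ ⟨RV, R, .ite N L P⟩
  | inLamBang {α : Label} {p : ℝ} {QV RV : Finset ℕ} {Q : HSpace QV} {R : HSpace RV}
      {M N : Term G.Op} (h : Step G α p ⟨QV, Q, M⟩ ⟨RV, R, N⟩) :
      Step G α p ⟨QV, Q, .lamBang M⟩ ⟨RV, R, .lamBang N⟩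
  | inLam {α : Label} {p : ℝ} {QV RV : Finset ℕ} {Q : HSpace QV} {R : HSpace RV} (π : LinPat)
      {M N : Term G.Op} (h : Step G α p ⟨QV, Q, M⟩ ⟨RV, R, N⟩) :
      Step G α p ⟨QV, Q, .lam π M⟩ ⟨RV, R, .lam π N⟩

variable {G : GateSet.{u}}

/-- `C` reduces to `D` in one step with label `α` and probability `p`. -/
def Red (α : Label) (p : ℝ) (C D : Conf G.Op) : Prop :=
  ∃ c d : Preconf G.Op, (⟦c⟧ : Conf G.Op) = C ∧ (⟦d⟧ : Conf G.Op) = D ∧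
    Step G α p c.toTriple d.toTriple

/-- `C` reduces to `D` by a step that is not a measurement. -/
def NonMeasRed (C D : Conf G.Op) : Prop := ∃ α : Label, α.NonMeas ∧ Red α 1 C D

/-- `D` and `E` are the results of the two different outcomes of one and the same measurement in
`C`, and `p` and `q` are the probabilities of these outcomes. -/
def MeasRed (C : Conf G.Op) (p : ℝ) (D : Conf G.Op) (q : ℝ) (E : Conf G.Op) : Prop :=
  ∃ (c d e : Preconf G.Op) (r : ℕ) (o : Bool),
    (⟦c⟧ : Conf G.Op) = C ∧ (⟦d⟧ : Conf G.Op) = D ∧ (⟦e⟧ : Conf G.Op) = E ∧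
    Step G (.meas r o) p c.toTriple d.toTriple ∧ Step G (.meas r (!o)) q c.toTriple e.toTriple

/-- Normal forms. -/
def NF (C : Conf G.Op) : Prop := ¬ ∃ (α : Label) (p : ℝ) (D : Conf G.Op), Red α p C D

/-! ## Probabilistic computations -/

/-- The possible nodes of a computation tree: `C` with no, or with one immediate subtree, and
`(p, q, C)` with two of them. -/
inductive Node (Op : Type u) : Type u where
  | leaf (C : Conf Op) : Node Op
  | one (C : Conf Op) : Node Op
  | two (p q : ℝ) (C : Conf Op) : Node Op

/-- The number of immediate subtrees. -/
def Node.arity {Op : Type u} : Node Op → ℕ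
  | .leaf _ => 0
  | .one _ => 1
  | .two _ _ _ => 2

/-- The configuration at a node. -/
def Node.conf {Op : Type u} : Node Op → Conf Op
  | .leaf C => C
  | .one C => C
  | .two _ _ C => C

/-- Possibly infinite trees. -/
def Tree (Op : Type u) : Type u := PFunctor.M ⟨Node Op, fun a => Fin a.arity⟩

namespace Tree

variable {Op : Type u}

/-- The tree `[C]`. -/
def leaf (C : Conf Op) : Tree Op := PFunctor.M.mk ⟨.leaf C, Fin.elim0⟩

/-- The tree `[C, R]`. -/
def one (C : Conf Op) (R : Tree Op) : Tree Op := PFunctor.M.mk ⟨.one C, fun _ => R⟩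

/-- The tree `[(p, q, C), R, Q]`. -/
def two (p q : ℝ) (C : Conf Op) (R Q : Tree Op) : Tree Op :=
  PFunctor.M.mk ⟨.two p q C, ![R, Q]⟩

/-- The configuration at the root. -/
def root (P : Tree Op) : Conf Op := (PFunctor.M.dest P).1.conf

end Tree

/-- The operator on sets of trees given by the three clauses that define probabilistic computations;
the leaves are restricted to the configurations that satisfy `ok`. -/
def compOperator (ok : Conf G.Op → Prop) : Set (Tree G.Op) →o Set (Tree G.Op) where
  toFun S := {P |
    (∃ C, ok C ∧ P = .leaf C) ∨
    (∃ C R, R ∈ S ∧ NonMeasRed C R.root ∧ P = .one C R) ∨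
    (∃ p q C R Q, R ∈ S ∧ Q ∈ S ∧ MeasRed C p R.root q Q.root ∧ P = .two p q C R Q)}
  monotone' := by
    rintro S T hST P (h | ⟨C, R, hR, h⟩ | ⟨p, q, C, R, Q, hR, hQ, h⟩)
    · exact .inl h
    · exact .inr (.inl ⟨C, R, hST hR, h⟩)
    · exact .inr (.inr ⟨p, q, C, R, Q, hST hR, hST hQ, h⟩)

variable (G) in
/-- The set of all probabilistic computations. -/
def probComps : Set (Tree G.Op) := OrderHom.gfp (compOperator fun _ => True)

variable (G) in
/-- The set of all maximal probabilistic computations: every leaf is in normal form. -/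
def maxProbComps : Set (Tree G.Op) := OrderHom.gfp (compOperator NF)

theorem maxProbComps_subset : maxProbComps G ⊆ probComps G := by
  refine OrderHom.le_gfp _ ?_
  have h : maxProbComps G = compOperator NF (maxProbComps G) :=
    (OrderHom.map_gfp (compOperator (G := G) NF)).symm
  intro P hP
  rw [h] at hP
  rcases hP with ⟨C, -, hC⟩ | hP
  · exact .inl ⟨C, trivial, hC⟩
  · exact .inr hP

/-- Finite trees. -/
inductive FinTree (Op : Type u) : Type u where
  | leaf (C : Conf Op) : FinTree Op
  | one (C : Conf Op) (R : FinTree Op) : FinTree Op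
  | two (p q : ℝ) (C : Conf Op) (R Q : FinTree Op) : FinTree Op

/-- The configuration at the root. -/
def FinTree.root {Op : Type u} : FinTree Op → Conf Op
  | .leaf C => C
  | .one C _ => C
  | .two _ _ C _ _ => C

/-- Finite probabilistic computations. -/
inductive IsFinComp : FinTree G.Op → Prop
  | leaf (C : Conf G.Op) : IsFinComp (.leaf C)
  | one {C : Conf G.Op} {R : FinTree G.Op} (hR : IsFinComp R) (h : NonMeasRed C R.root) :
      IsFinComp (.one C R)
  | two {p q : ℝ} {C : Conf G.Op} {R Q : FinTree G.Op} (hR : IsFinComp R) (hQ : IsFinComp Q)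
      (h : MeasRed C p R.root q Q.root) : IsFinComp (.two p q C R Q)

/-- `R` is a finite initial part of `P`. -/
def FinTree.Sub {Op : Type u} : FinTree Op → Tree Op → Prop
  | .leaf C, P => P.root = C
  | .one C Q, P => ∃ S : Tree Op, P = .one C S ∧ Q.Sub S
  | .two p q C Q S, P => ∃ U V : Tree Op, P = .two p q C U V ∧ Q.Sub U ∧ S.Sub V

open Classical in
/-- The probability of observing `D` as a leaf of a finite computation. -/
def FinTree.prob {Op : Type u} : FinTree Op → Conf Op → ℝ
  | .leaf C, D => if C = D then delta C else 0
  | .one _ R, D => R.prob D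
  | .two p q _ R Q, D => p * R.prob D + q * Q.prob D

theorem measProb_nonneg {QV : Finset ℕ} (r : ℕ) (c : Bool) (Q : HSpace QV) :
    0 ≤ measProb r c Q := by
  rw [measProb, LinearMap.adjoint_inner_right]
  exact inner_self_nonneg

theorem measProb_add {QV : Finset ℕ} {r : ℕ} (hr : r ∈ QV) (c : Bool) (Q : HSpace QV) :
    measProb r c Q + measProb r (!c) Q = ‖Q‖ ^ 2 := by
  have key : ∀ c, measProb r c Q = ∑ b : QV.erase r → Bool, ‖Q (extendAt r c b)‖ ^ 2 := fun c => by
    rw [measProb, LinearMap.adjoint_inner_right, inner_self_eq_norm_sq, EuclideanSpace.norm_sq_eq]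
    rfl
  have e : ∀ c, ∑ b : QV.erase r → Bool, ‖Q (extendAt r c b)‖ ^ 2 =
      ∑ b : QV → Bool with b ⟨r, hr⟩ = c, ‖Q b‖ ^ 2 := fun c => by
    refine Finset.sum_bij' (fun b _ => extendAt r c b)
      (fun b _ s => b ⟨s, Finset.mem_of_mem_erase s.2⟩) ?_ ?_ ?_ ?_ ?_
    · intro b _
      simp [extendAt]
    · intro b _
      simp
    · intro b _
      funext s
      simp [extendAt, (Finset.mem_erase.1 s.2).1]
    · intro b hb
      funext s
      obtain ⟨s, hs⟩ := s
      by_cases h : s = r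
      · subst h
        simpa [extendAt] using (Finset.mem_filter.1 hb).2.symm
      · simp [extendAt, h]
    · intro b _
      rfl
  rw [key, key, e, e, EuclideanSpace.norm_sq_eq, ← Finset.sum_filter_add_sum_filter_not Finset.univ
    (fun b : QV → Bool => b ⟨r, hr⟩ = c)]
  congr 2
  ext b
  simp [Bool.eq_not]

theorem Step.measProb_eq {α : Label} {p : ℝ} {c d : Triple G.Op} (h : Step G α p c d) :
    ∀ r o, α = .meas r o → r ∈ c.QV ∧ p = measProb r o c.reg := by
  induction h with
  | meas QV Q r c hr =>
    rintro r o ⟨⟩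
    exact ⟨hr, rfl⟩
  | _ => first | (rintro r o ⟨⟩; done) | assumption

theorem MeasRed.bounds {C D E : Conf G.Op} {p q : ℝ} (h : MeasRed C p D q E) :
    0 ≤ p ∧ 0 ≤ q ∧ p + q ≤ 1 := by
  obtain ⟨c, d, e, r, o, -, -, -, h₁, h₂⟩ := h
  obtain ⟨hr, rfl⟩ := h₁.measProb_eq r o rfl
  obtain ⟨-, rfl⟩ := h₂.measProb_eq r _ rfl
  refine ⟨measProb_nonneg _ _ _, measProb_nonneg _ _ _, ?_⟩
  rw [measProb_add hr]
  rcases c.isRegister with h | h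
  · simp [h]
  · simp [h]

theorem IsFinComp.prob_mem_Icc {R : FinTree G.Op} (hR : IsFinComp R) (D : Conf G.Op) :
    R.prob D ∈ Set.Icc (0 : ℝ) 1 := by
  induction hR with
  | leaf C =>
    simp only [FinTree.prob, delta]
    split_ifs <;> simp
  | one _ _ ih => exact ih
  | two _ _ h ih₁ ih₂ =>
    obtain ⟨hp, hq, hpq⟩ := h.bounds
    obtain ⟨h₁, h₁'⟩ := ih₁
    obtain ⟨h₂, h₂'⟩ := ih₂
    refine ⟨add_nonneg (mul_nonneg hp h₁) (mul_nonneg hq h₂), ?_⟩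
    simp only [FinTree.prob]
    nlinarith [mul_le_mul_of_nonneg_left h₁' hp, mul_le_mul_of_nonneg_left h₂' hq]

/-- The probability of observing `D` as a leaf of `P`: the least upper bound over all finite
sub-computations of `P`. -/
def prob (P : Tree G.Op) (D : Conf G.Op) : ℝ :=
  sSup {x | ∃ R : FinTree G.Op, IsFinComp R ∧ R.Sub P ∧ x = R.prob D}

/-- The least upper bound in the definition of `prob` exists. -/
theorem isLUB_prob (P : Tree G.Op) (D : Conf G.Op) :
    IsLUB {x | ∃ R : FinTree G.Op, IsFinComp R ∧ R.Sub P ∧ x = R.prob D} (prob P D) := by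
  refine isLUB_csSup ⟨_, .leaf P.root, .leaf _, rfl, rfl⟩ ⟨1, ?_⟩
  rintro x ⟨R, hR, -, rfl⟩
  exact (hR.prob_mem_Icc D).2

/-! ## Mixed states -/

/-- Finitely supported probability distributions on configurations. -/
structure MixedState (Op : Type u) where
  weight : Conf Op →₀ ℝ
  mem_Icc : ∀ C, weight C ∈ Set.Icc (0 : ℝ) 1
  sum_eq_one : ∑ C ∈ weight.support, weight C = 1

instance {Op : Type u} : CoeFun (MixedState Op) fun _ => Conf Op → ℝ := ⟨fun M => M.weight⟩

/-- The mixed states to which a single configuration of a mixed state may be rewritten. -/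
def ConfStep (C : Conf G.Op) (N : MixedState G.Op) : Prop :=
  (NF C ∧ N.weight = Finsupp.single C 1) ∨
  (∃ D, NonMeasRed C D ∧ N.weight = Finsupp.single D 1) ∨
  (∃ p D q E, MeasRed C p D q E ∧ N.weight = Finsupp.single D p + Finsupp.single E q)

/-- The reduction relation on mixed states. -/
def MixedRed (M M' : MixedState G.Op) : Prop :=
  ∃ N : Conf G.Op → MixedState G.Op,
    (∀ C ∈ M.weight.support, ConfStep C (N C)) ∧
    ∀ D, M' D = ∑ C ∈ M.weight.support, M C * N C D

/-- `M₀, M₁, M₂, …` is an infinite mixed computation (and as such it is maximal). -/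
def IsMaxMixedComp (M : ℕ → MixedState G.Op) : Prop := ∀ i, MixedRed (M i) (M (i + 1))

end

end QStar

namespace QStar

/-! ## Registers -/

/-! A mixed state merges equal configurations, so at time `j` a mixed computation makes one choice
of move for each configuration of its support. These choices, completed by arbitrary legal moves off
the support, form a strategy `s`: a legal move for every time and configuration
(`IsMaxMixedComp.exists_strategy`). Unfolding `s` coinductively from time `0` and `C` gives the tree
`strategyTree s 0 C`. It is maximal because halting is legal only in normal form.

Both sides are then compared with `stepProb s D k j C`, the probability that `s`, started in `C` at
time `j`, is at `D` after `k` steps. By linearity, the mass of `D` at time `k` is the average of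
`stepProb s D k 0 C` over the initial state (`mixed_eq_sum_stepProb`). If `D` is a normal form, mass
that reaches `D` stays there, so `stepProb` is monotone in `k`. If moreover its register is nonzero,
the supremum over `k` is `prob (strategyTree s j C) D`: truncation at depth `k` is a finite
sub-computation, and each finite sub-computation is dominated by some depth (`isLUB_stepProb`). The
suprema are limits of monotone sequences, so they commute with the finite sum over the initial
support.

If the register of `D` is zero, `delta` makes every tree probability vanish. The mass of `D`
vanishes as well when all initial registers are nonzero, since steps of nonzero probability preserve
this property (`not_isZero_of_mem_support`). -/

theorem norm_destr_sq {QV : Finset ℕ} (r : ℕ) (c : Bool) (Q : HSpace QV) :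
    ‖destr r c Q‖ ^ 2 = measProb r c Q := by
  rw [measProb, LinearMap.adjoint_inner_right, inner_self_eq_norm_sq]

theorem norm_measured {QV : Finset ℕ} {r : ℕ} {c : Bool} {Q : HSpace QV}
    (h : measProb r c Q ≠ 0) : ‖measured r c Q‖ = 1 := by
  have hd : ‖destr r c Q‖ = √(measProb r c Q) := by
    rw [← norm_destr_sq, Real.sqrt_sq (norm_nonneg _)]
  have hs : √(measProb r c Q) ≠ 0 :=
    (Real.sqrt_pos.2 ((measProb_nonneg r c Q).lt_of_ne' h)).ne'
  rw [measured, if_neg h, norm_smul, hd, Complex.norm_real, Real.norm_eq_abs,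
    abs_of_nonneg (by positivity), one_div_mul_cancel hs]

theorem isRegister_measured {QV : Finset ℕ} (r : ℕ) (c : Bool) (Q : HSpace QV) :
    IsRegister (measured r c Q) := by
  by_cases h : measProb r c Q = 0
  · left
    rw [measured, if_pos h]
    have := norm_destr_sq r c Q
    rw [h] at this
    exact norm_eq_zero.1 (pow_eq_zero_iff two_ne_zero |>.1 this)
  · exact .inr (norm_measured h)

/-- Overwriting the values on the range of `r` twice leaves only the later values, so the nested
sums collapse to a matrix product. -/
theorem applyGate_mul {QV : Finset ℕ} {n : ℕ} (A B : Matrix (Fin n → Bool) (Fin n → Bool) ℂ)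
    {r : Fin n → QV} (hr : Function.Injective r) (Q : HSpace QV) :
    applyGate B r (applyGate A r Q) = applyGate (B * A) r Q := by
  have key (a a' : Fin n → Bool) (b : QV → Bool) :
      Function.extend r a' (Function.extend r a b) = Function.extend r a' b := by
    funext s
    by_cases hs : ∃ i, r i = s
    · obtain ⟨i, rfl⟩ := hs
      simp [hr.extend_apply]
    · simp [Function.extend_apply' _ _ _ hs]
  ext b
  simp only [applyGate, hr.extend_apply, key, Finset.mul_sum, Matrix.mul_apply, Finset.sum_mul]
  rw [Finset.sum_comm]
  simp only [mul_assoc]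

theorem applyGate_one {QV : Finset ℕ} {n : ℕ} {r : Fin n → QV} (hr : Function.Injective r)
    (Q : HSpace QV) : applyGate 1 r Q = Q := by
  ext b
  have : Function.extend r (fun i => b (r i)) b = b := by
    funext s
    by_cases hs : ∃ i, r i = s
    · obtain ⟨i, rfl⟩ := hs
      simp [hr.extend_apply]
    · simp [Function.extend_apply' _ _ _ hs]
  simp [applyGate, Matrix.one_apply, this]

/-- The adjoint matrix, applied to the same qubits, undoes the gate. -/
theorem applyGate_ne_zero {QV : Finset ℕ} {n : ℕ}
    (A : Matrix.unitaryGroup (Fin n → Bool) ℂ) {r : Fin n → QV} (hr : Function.Injective r)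
    {Q : HSpace QV} (hQ : Q ≠ 0) :
    applyGate (A : Matrix (Fin n → Bool) (Fin n → Bool) ℂ) r Q ≠ 0 := by
  intro h
  apply hQ
  rw [← applyGate_one hr Q, ← Matrix.UnitaryGroup.star_mul_self A, ← applyGate_mul _ _ hr, h]
  ext b
  simp [applyGate]

theorem tensorNew_ne_zero {QV : Finset ℕ} {r : ℕ} (hr : r ∉ QV) (c : Bool) {Q : HSpace QV}
    (hQ : Q ≠ 0) : tensorNew r c Q ≠ 0 := by
  intro h
  apply hQ
  ext b
  -- Evaluation at the assignment that extends `b` by `r ↦ c` recovers the coefficient of `Q` at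
  -- `b`.
  have := congrArg (fun R : HSpace (insert r QV) =>
    R fun s => if hs : (s : ℕ) ∈ QV then b ⟨s, hs⟩ else c) h
  simpa [tensorNew, hr] using this

/-! ## Reduction steps -/

variable {G : GateSet.{u}}

/-- Gates are invertible, a new qubit is tensored on injectively, and an outcome of nonzero
probability is normalised. The condition `p ≠ 0` matters: an outcome of probability zero yields the
zero register. -/
theorem Step.reg_ne_zero {α : Label} {p : ℝ} {c d : Triple G.Op} (h : Step G α p c d) :
    p ≠ 0 → c.reg ≠ 0 → d.reg ≠ 0 := by
  induction h with
  | Uq QV Q U r hr => exact fun _ => applyGate_ne_zero _ hr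
  | meas QV Q r c hr =>
    intro hp _ h0
    have h1 := norm_measured hp
    simp only at h0
    rw [h0, norm_zero] at h1
    exact zero_ne_one h1
  | new QV Q r c hr => exact fun _ => tensorNew_ne_zero hr c
  | _ => first | assumption | exact fun _ h => h

theorem Step.eq_one {α : Label} {p : ℝ} {c d : Triple G.Op} (h : Step G α p c d) :
    α.NonMeas → p = 1 := by
  induction h with
  | meas => exact False.elim
  | _ => first | assumption | exact fun _ => rfl

/-- The other outcome of a measurement. -/
theorem Step.other_outcome {α : Label} {p : ℝ} {c d : Triple G.Op} (h : Step G α p c d) :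
    ∀ r o, α = .meas r o → d.QV = c.QV.erase r ∧ ∃ (q : ℝ) (N : Term G.Op),
      Step G (.meas r !o) q c ⟨c.QV.erase r, measured r (!o) c.reg, N⟩ ∧
        N.qvars = d.term.qvars := by
  induction h with
  | meas QV Q r c hr =>
    rintro r o ⟨⟩
    exact ⟨rfl, _, _, .meas QV Q r _ hr, rfl⟩
  | tup M i h ih =>
    intro r o hα
    obtain ⟨hV, q, N, hN, hq⟩ := ih r o hα
    refine ⟨hV, q, _, .tup M i hN, ?_⟩
    simp only [Term.qvars]
    congr 1
    funext j
    by_cases hj : j = i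
    · subst hj
      simpa using hq
    · simp [hj]
  | appRight M h ih =>
    intro r o hα
    obtain ⟨hV, q, N, hN, hq⟩ := ih r o hα
    exact ⟨hV, q, _, .appRight M hN, by simp_all [Term.qvars]⟩
  | appLeft M h ih =>
    intro r o hα
    obtain ⟨hV, q, N, hN, hq⟩ := ih r o hα
    exact ⟨hV, q, _, .appLeft M hN, by simp_all [Term.qvars]⟩
  | inNew h ih =>
    intro r o hα
    obtain ⟨hV, q, N, hN, hq⟩ := ih r o hα
    exact ⟨hV, q, _, .inNew hN, hq⟩
  | inMeas h ih =>
    intro r o hα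
    obtain ⟨hV, q, N, hN, hq⟩ := ih r o hα
    exact ⟨hV, q, _, .inMeas hN, hq⟩
  | inIf L P h ih =>
    intro r o hα
    obtain ⟨hV, q, N, hN, hq⟩ := ih r o hα
    exact ⟨hV, q, _, .inIf L P hN, by simp_all [Term.qvars]⟩
  | inLamBang h ih =>
    intro r o hα
    obtain ⟨hV, q, N, hN, hq⟩ := ih r o hα
    exact ⟨hV, q, _, .inLamBang hN, hq⟩
  | inLam π h ih =>
    intro r o hα
    obtain ⟨hV, q, N, hN, hq⟩ := ih r o hα
    exact ⟨hV, q, _, .inLam π hN, hq⟩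
  | _ => rintro r o ⟨⟩

theorem Red.not_isZero {α : Label} {p : ℝ} {C D : Conf G.Op} (h : Red α p C D) (hp : p ≠ 0)
    (hC : ¬ C.IsZero) : ¬ D.IsZero := by
  obtain ⟨c, d, rfl, rfl, h⟩ := h
  exact h.reg_ne_zero hp hC

theorem MeasRed.left {C D E : Conf G.Op} {p q : ℝ} (h : MeasRed C p D q E) :
    ∃ α, Red α p C D := by
  obtain ⟨c, d, e, r, o, hc, hd, -, h, -⟩ := h
  exact ⟨_, c, d, hc, hd, h⟩

theorem MeasRed.right {C D E : Conf G.Op} {p q : ℝ} (h : MeasRed C p D q E) :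
    ∃ α, Red α q C E := by
  obtain ⟨c, d, e, r, o, hc, -, he, -, h⟩ := h
  exact ⟨_, c, e, hc, he, h⟩

/-- A configuration that is not a normal form has a step in the sense of computations. -/
theorem exists_nonMeasRed_or_measRed {C : Conf G.Op} (hC : ¬ NF C) :
    (∃ D, NonMeasRed C D) ∨ ∃ p D q E, MeasRed C p D q E := by
  obtain ⟨α, p, D, c, d, rfl, rfl, h⟩ := not_not.1 hC
  by_cases hα : α.NonMeas
  · obtain rfl := h.eq_one hα
    exact .inl ⟨_, α, hα, c, d, rfl, rfl, h⟩
  · cases α with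
    | meas r o =>
      obtain ⟨hV, q, N, hN, hq⟩ := h.other_outcome r o rfl
      refine .inr ⟨p, ⟦d⟧, q, ⟦⟨⟨c.QV.erase r, measured r (!o) c.reg, N⟩,
        isRegister_measured _ _ _, ?_⟩⟧, c, d, _, r, o, rfl, rfl, rfl, h, hN⟩
      simp only [hq, ← hV]
      exact d.qvars_subset
    | _ => exact absurd trivial hα

/-! ## Trees -/

namespace Tree

variable {Op : Type u}

@[simp] theorem dest_leaf (C : Conf Op) :
    PFunctor.M.dest (leaf C) = ⟨.leaf C, Fin.elim0⟩ := PFunctor.M.dest_mk _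

@[simp] theorem dest_one (C : Conf Op) (R : Tree Op) :
    PFunctor.M.dest (one C R) = ⟨.one C, fun _ => R⟩ := PFunctor.M.dest_mk _

@[simp] theorem dest_two (p q : ℝ) (C : Conf Op) (R S : Tree Op) :
    PFunctor.M.dest (two p q C R S) = ⟨.two p q C, ![R, S]⟩ := PFunctor.M.dest_mk _

@[simp] theorem root_leaf (C : Conf Op) : (leaf C).root = C := by simp [root, Node.conf]

@[simp] theorem root_one (C : Conf Op) (R : Tree Op) : (one C R).root = C := by
  simp [root, Node.conf]

@[simp] theorem root_two (p q : ℝ) (C : Conf Op) (R S : Tree Op) : (two p q C R S).root = C := by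
  simp [root, Node.conf]

theorem leaf_ne_one (C D : Conf Op) (R : Tree Op) : leaf C ≠ one D R := by
  intro h
  have := congrArg (fun P : Tree Op => (PFunctor.M.dest P).1) h
  simp at this

theorem leaf_ne_two (C D : Conf Op) (p q : ℝ) (R S : Tree Op) : leaf C ≠ two p q D R S := by
  intro h
  have := congrArg (fun P : Tree Op => (PFunctor.M.dest P).1) h
  simp at this

theorem one_ne_two (C D : Conf Op) (p q : ℝ) (R S T : Tree Op) : one C T ≠ two p q D R S := by
  intro h
  have := congrArg (fun P : Tree Op => (PFunctor.M.dest P).1) h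
  simp at this

theorem one_inj {C D : Conf Op} {R S : Tree Op} (h : one C R = one D S) : C = D ∧ R = S := by
  obtain ⟨h₁, h₂⟩ := Sigma.mk.inj (PFunctor.M.mk_inj h)
  cases h₁
  exact ⟨rfl, congrFun (eq_of_heq h₂) (0 : Fin 1)⟩

theorem two_inj {p q p' q' : ℝ} {C D : Conf Op} {R S R' S' : Tree Op}
    (h : two p q C R S = two p' q' D R' S') :
    p = p' ∧ q = q' ∧ C = D ∧ R = R' ∧ S = S' := by
  obtain ⟨h₁, h₂⟩ := Sigma.mk.inj (PFunctor.M.mk_inj h)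
  cases h₁
  exact ⟨rfl, rfl, rfl, congrFun (eq_of_heq h₂) (0 : Fin 2),
    congrFun (eq_of_heq h₂) (1 : Fin 2)⟩

end Tree

/-- Lets a reduction towards the root of an infinite tree serve as a reduction towards the root of
its finite part, as `IsFinComp` requires. -/
theorem FinTree.Sub.root_eq {Op : Type u} {R : FinTree Op} {P : Tree Op} (h : R.Sub P) :
    P.root = R.root := by
  cases R with
  | leaf C => exact h
  | one C R =>
    obtain ⟨S, rfl, -⟩ := h
    exact Tree.root_one _ _
  | two p q C R S =>
    obtain ⟨U, V, rfl, -⟩ := h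
    exact Tree.root_two _ _ _ _ _

/-! ## Strategies -/

/-- What is done with a configuration in one step of a mixed computation. -/
inductive Move (Op : Type u) : Type u where
  | halt : Move Op
  | one (D : Conf Op) : Move Op
  | two (p : ℝ) (D : Conf Op) (q : ℝ) (E : Conf Op) : Move Op

/-- The move is a legal one for `C`. -/
def Move.Valid (C : Conf G.Op) : Move G.Op → Prop
  | .halt => NF C
  | .one D => NonMeasRed C D
  | .two p D q E => MeasRed C p D q E

noncomputable section

/-- The distribution on configurations to which a move leads from `C`. -/
def Move.weight {Op : Type u} (C : Conf Op) : Move Op → Conf Op →₀ ℝ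
  | .halt => Finsupp.single C 1
  | .one D => Finsupp.single D 1
  | .two p D q E => Finsupp.single D p + Finsupp.single E q

/-- Needed off the support of the mixed states: a tree also contains outcomes of probability zero
and must continue below them to be maximal. -/
theorem exists_valid_move (C : Conf G.Op) : ∃ m : Move G.Op, m.Valid C := by
  by_cases hC : NF C
  · exact ⟨.halt, hC⟩
  · rcases exists_nonMeasRed_or_measRed hC with ⟨D, h⟩ | ⟨p, D, q, E, h⟩
    · exact ⟨.one D, h⟩
    · exact ⟨.two p D q E, h⟩

theorem ConfStep.exists_move {C : Conf G.Op} {N : MixedState G.Op} (h : ConfStep C N) :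
    ∃ m : Move G.Op, m.Valid C ∧ N.weight = m.weight C := by
  rcases h with ⟨h, hN⟩ | ⟨D, h, hN⟩ | ⟨p, D, q, E, h, hN⟩
  · exact ⟨.halt, h, hN⟩
  · exact ⟨.one D, h, hN⟩
  · exact ⟨.two p D q E, h, hN⟩

theorem Move.Valid.eq_halt {C : Conf G.Op} {m : Move G.Op} (h : m.Valid C) (hC : NF C) :
    m = .halt := by
  cases m with
  | halt => rfl
  | one D =>
    obtain ⟨α, -, h⟩ := h
    exact (hC ⟨_, _, _, h⟩).elim
  | two p D q E =>
    obtain ⟨α, h⟩ := MeasRed.left h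
    exact (hC ⟨_, _, _, h⟩).elim

theorem Move.Valid.not_isZero {C D : Conf G.Op} {m : Move G.Op} (h : m.Valid C)
    (hC : ¬ C.IsZero) (hD : m.weight C D ≠ 0) : ¬ D.IsZero := by
  cases m with
  | halt =>
    obtain ⟨rfl, -⟩ := Finsupp.single_apply_ne_zero.1 hD
    exact hC
  | one E =>
    obtain ⟨rfl, -⟩ := Finsupp.single_apply_ne_zero.1 hD
    obtain ⟨α, -, h⟩ := h
    exact h.not_isZero one_ne_zero hC
  | two p E q F =>
    rw [Move.weight, Finsupp.add_apply] at hD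
    -- `E` and `F` may coincide, so it is only known that one of the two summands is nonzero at `D`;
    -- its outcome then has nonzero probability.
    by_cases h₁ : Finsupp.single E p D = 0
    · rw [h₁, zero_add] at hD
      obtain ⟨rfl, hq⟩ := Finsupp.single_apply_ne_zero.1 hD
      obtain ⟨α, h⟩ := MeasRed.right h
      exact h.not_isZero hq hC
    · obtain ⟨rfl, hp⟩ := Finsupp.single_apply_ne_zero.1 h₁
      obtain ⟨α, h⟩ := MeasRed.left h
      exact h.not_isZero hp hC

/-! ### The tree and the step probabilities of a strategy -/

section Strategy

variable {Op : Type u} (s : ℕ → Conf Op → Move Op)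

/-- One layer of the computation tree of a strategy. -/
def strategyNode (x : ℕ × Conf Op) :
    (⟨Node Op, fun a => Fin a.arity⟩ : PFunctor.{u, 0}) (ℕ × Conf Op) :=
  match s x.1 x.2 with
  | .halt => ⟨.leaf x.2, Fin.elim0⟩
  | .one D => ⟨.one x.2, fun _ => (x.1 + 1, D)⟩
  | .two p D q E => ⟨.two p q x.2, ![(x.1 + 1, D), (x.1 + 1, E)]⟩

/-- The computation tree of a strategy, from the configuration `C` at time `j` on. -/
def strategyTree (j : ℕ) (C : Conf Op) : Tree Op := PFunctor.M.corec (strategyNode s) (j, C)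

variable {s}

theorem strategyTree_halt {j : ℕ} {C : Conf Op} (h : s j C = .halt) :
    strategyTree s j C = .leaf C := by
  rw [strategyTree, PFunctor.M.corec_def, strategyNode]
  simp only [h]
  exact congrArg (fun f => PFunctor.M.mk (F := ⟨Node Op, fun a => Fin a.arity⟩) ⟨.leaf C, f⟩)
    (funext fun i : Fin 0 => i.elim0)

theorem strategyTree_one {j : ℕ} {C D : Conf Op} (h : s j C = .one D) :
    strategyTree s j C = .one C (strategyTree s (j + 1) D) := by
  rw [strategyTree, PFunctor.M.corec_def, strategyNode]
  simp only [h]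
  rfl

theorem strategyTree_two {j : ℕ} {C D E : Conf Op} {p q : ℝ} (h : s j C = .two p D q E) :
    strategyTree s j C =
      .two p q C (strategyTree s (j + 1) D) (strategyTree s (j + 1) E) := by
  rw [strategyTree, PFunctor.M.corec_def, strategyNode]
  simp only [h]
  -- The corecursor maps over the vector of children, which agrees with the vector of subtrees only
  -- entry by entry.
  refine congrArg (fun f => PFunctor.M.mk (F := ⟨Node Op, fun a => Fin a.arity⟩)
    ⟨.two p q C, f⟩) (funext fun i : Fin 2 => ?_)
  fin_cases i <;> rfl

@[simp] theorem root_strategyTree (j : ℕ) (C : Conf Op) : (strategyTree s j C).root = C := by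
  cases h : s j C with
  | halt => simp [strategyTree_halt h]
  | one D => simp [strategyTree_one h]
  | two p D q E => simp [strategyTree_two h]

variable (s) in
open Classical in
/-- The probability to be at `D` after `k` steps from `C` at time `j`. -/
def stepProb (D : Conf Op) : ℕ → ℕ → Conf Op → ℝ
  | 0, _, C => if C = D then 1 else 0
  | k + 1, j, C => Finsupp.linearCombination ℝ (stepProb D k (j + 1)) ((s j C).weight C)

theorem stepProb_succ_halt {D : Conf Op} {k j : ℕ} {C : Conf Op} (h : s j C = .halt) :
    stepProb s D (k + 1) j C = stepProb s D k (j + 1) C := by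
  simp [stepProb, h, Move.weight]

theorem stepProb_succ_one {D : Conf Op} {k j : ℕ} {C E : Conf Op} (h : s j C = .one E) :
    stepProb s D (k + 1) j C = stepProb s D k (j + 1) E := by
  simp [stepProb, h, Move.weight]

theorem stepProb_succ_two {D : Conf Op} {k j : ℕ} {C E F : Conf Op} {p q : ℝ}
    (h : s j C = .two p E q F) :
    stepProb s D (k + 1) j C =
      p * stepProb s D k (j + 1) E + q * stepProb s D k (j + 1) F := by
  simp [stepProb, h, Move.weight]

end Strategy

/-! ### Step probabilities and finite sub-computations -/

section ValidStrategy

variable {s : ℕ → Conf G.Op → Move G.Op} (hs : ∀ j C, (s j C).Valid C)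

include hs

theorem strategyTree_mem_maxProbComps (j : ℕ) (C : Conf G.Op) :
    strategyTree s j C ∈ maxProbComps G := by
  -- Coinduction: the set of all trees of the strategy is closed under taking immediate subtrees, so
  -- it lies below the greatest fixed point.
  have h : {P | ∃ j C, P = strategyTree s j C} ≤ maxProbComps G := by
    refine OrderHom.le_gfp _ ?_
    rintro P ⟨j, C, rfl⟩
    have hv := hs j C
    cases h : s j C with
    | halt =>
      rw [h] at hv
      exact .inl ⟨C, hv, strategyTree_halt h⟩
    | one D =>
      rw [h] at hv
      exact .inr (.inl ⟨C, _, ⟨_, _, rfl⟩, by simpa [Move.Valid] using hv, strategyTree_one h⟩)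
    | two p D q E =>
      rw [h] at hv
      exact .inr (.inr ⟨p, q, C, _, _, ⟨_, _, rfl⟩, ⟨_, _, rfl⟩,
        by simpa [Move.Valid] using hv, strategyTree_two h⟩)
  exact h ⟨j, C, rfl⟩

theorem stepProb_of_nf {D C : Conf G.Op} (hC : NF C) (k j : ℕ) :
    stepProb s D k j C = stepProb s D 0 j C := by
  induction k generalizing j with
  | zero => rfl
  | succ k ih =>
    rw [stepProb_succ_halt ((hs j C).eq_halt hC), ih]
    rfl

theorem stepProb_nonneg (D : Conf G.Op) (k j : ℕ) (C : Conf G.Op) :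
    0 ≤ stepProb s D k j C := by
  induction k generalizing j C with
  | zero =>
    rw [stepProb]
    split_ifs <;> norm_num
  | succ k ih =>
    have hv := hs j C
    cases h : s j C with
    | halt => exact (ih _ _).trans_eq (stepProb_succ_halt h).symm
    | one E => exact (ih _ _).trans_eq (stepProb_succ_one h).symm
    | two p E q F =>
      rw [h] at hv
      obtain ⟨hp, hq, -⟩ := MeasRed.bounds hv
      rw [stepProb_succ_two h]
      exact add_nonneg (mul_nonneg hp (ih _ _)) (mul_nonneg hq (ih _ _))

/-- A normal form can only halt, so mass that has arrived at `D` never leaves it. -/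
theorem stepProb_le_succ {D : Conf G.Op} (hD : NF D) (k j : ℕ) (C : Conf G.Op) :
    stepProb s D k j C ≤ stepProb s D (k + 1) j C := by
  induction k generalizing j C with
  | zero =>
    by_cases hC : C = D
    · subst hC
      exact (stepProb_of_nf hs hD _ _).ge
    · rw [stepProb, if_neg hC]
      exact stepProb_nonneg hs _ _ _ _
  | succ k ih =>
    have hv := hs j C
    cases h : s j C with
    | halt =>
      rw [stepProb_succ_halt h, stepProb_succ_halt h]
      exact ih _ _
    | one E =>
      rw [stepProb_succ_one h, stepProb_succ_one h]
      exact ih _ _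
    | two p E q F =>
      rw [h] at hv
      obtain ⟨hp, hq, -⟩ := MeasRed.bounds hv
      rw [stepProb_succ_two h, stepProb_succ_two h]
      exact add_le_add (mul_le_mul_of_nonneg_left (ih _ _) hp)
        (mul_le_mul_of_nonneg_left (ih _ _) hq)

theorem monotone_stepProb {D : Conf G.Op} (hD : NF D) (j : ℕ) (C : Conf G.Op) :
    Monotone fun k => stepProb s D k j C :=
  monotone_nat_of_le_succ fun k => stepProb_le_succ hs hD k j C

/-- Any `k` at least the depth of `R` works: by then all mass that `R` finds at `D` has arrived and
stays. There is only an inequality, because `R` may stop before other mass arrives and because of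
`delta`. -/
theorem FinTree.Sub.exists_prob_le {D : Conf G.Op} (hD : NF D) {R : FinTree G.Op} {j : ℕ}
    {C : Conf G.Op} (h : R.Sub (strategyTree s j C)) : ∃ k, R.prob D ≤ stepProb s D k j C := by
  induction R generalizing j C with
  | leaf C' =>
    obtain rfl : C = C' := by simpa [FinTree.root] using h.root_eq
    refine ⟨0, ?_⟩
    rw [FinTree.prob, stepProb, delta]
    split_ifs <;> norm_num
  | one C' R ih =>
    obtain ⟨S, hS, hR⟩ := h
    cases hm : s j C with
    | halt => exact absurd ((strategyTree_halt hm).symm.trans hS) (Tree.leaf_ne_one _ _ _)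
    | one E =>
      obtain ⟨-, rfl⟩ := Tree.one_inj ((strategyTree_one hm).symm.trans hS)
      obtain ⟨k, hk⟩ := ih hR
      exact ⟨k + 1, hk.trans_eq (stepProb_succ_one hm).symm⟩
    | two p E q F =>
      exact absurd (hS.symm.trans (strategyTree_two hm)) (Tree.one_ne_two _ _ _ _ _ _ _)
  | two p q C' R R' ih ih' =>
    obtain ⟨U, V, hS, hR, hR'⟩ := h
    have hv := hs j C
    cases hm : s j C with
    | halt => exact absurd ((strategyTree_halt hm).symm.trans hS) (Tree.leaf_ne_two _ _ _ _ _ _)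
    | one E =>
      exact absurd ((strategyTree_one hm).symm.trans hS) (Tree.one_ne_two _ _ _ _ _ _ _)
    | two p' E q' F =>
      rw [hm] at hv
      obtain ⟨rfl, rfl, -, rfl, rfl⟩ := Tree.two_inj ((strategyTree_two hm).symm.trans hS)
      obtain ⟨hp, hq, -⟩ := MeasRed.bounds hv
      obtain ⟨k, hk⟩ := ih hR
      obtain ⟨l, hl⟩ := ih' hR'
      -- Monotonicity brings both branches to a common number of steps; one more step is the
      -- measurement itself.
      refine ⟨max k l + 1, ?_⟩
      rw [stepProb_succ_two hm, FinTree.prob]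
      exact add_le_add
        (mul_le_mul_of_nonneg_left
          (hk.trans (monotone_stepProb hs hD _ _ (le_max_left k l))) hp)
        (mul_le_mul_of_nonneg_left
          (hl.trans (monotone_stepProb hs hD _ _ (le_max_right k l))) hq)

/-- The witness is the strategy tree cut off at depth `k`. A branch that halts earlier keeps its
leaf, which stands for a configuration that waits. As the register of `D` is nonzero, `delta` is `1`
on the leaves equal to `D`. -/
theorem exists_isFinComp_stepProb_eq {D : Conf G.Op} (hD : ¬ D.IsZero) (k j : ℕ)
    (C : Conf G.Op) : ∃ R : FinTree G.Op, IsFinComp R ∧ R.Sub (strategyTree s j C) ∧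
      stepProb s D k j C = R.prob D := by
  have hleaf (j : ℕ) (C : Conf G.Op) : ∃ R : FinTree G.Op, IsFinComp R ∧
      R.Sub (strategyTree s j C) ∧ stepProb s D 0 j C = R.prob D := by
    refine ⟨.leaf C, .leaf C, root_strategyTree j C, ?_⟩
    by_cases hC : C = D
    · subst hC
      simp [stepProb, FinTree.prob, delta, hD]
    · simp [stepProb, FinTree.prob, hC]
  induction k generalizing j C with
  | zero => exact hleaf j C
  | succ k ih =>
    have hv := hs j C
    cases h : s j C with
    | halt =>
      rw [h] at hv
      rw [stepProb_of_nf hs hv]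
      exact hleaf j C
    | one E =>
      rw [h] at hv
      obtain ⟨R, hR, hS, he⟩ := ih (j + 1) E
      have hr := hS.root_eq
      rw [root_strategyTree] at hr
      subst hr
      exact ⟨.one C R, .one hR hv, ⟨_, strategyTree_one h, hS⟩, (stepProb_succ_one h).trans he⟩
    | two p E q F =>
      rw [h] at hv
      obtain ⟨R, hR, hS, he⟩ := ih (j + 1) E
      obtain ⟨R', hR', hS', he'⟩ := ih (j + 1) F
      have hr := hS.root_eq
      have hr' := hS'.root_eq
      rw [root_strategyTree] at hr hr'
      subst hr hr'
      refine ⟨.two p q C R R', .two hR hR' hv, ⟨_, _, strategyTree_two h, hS, hS'⟩, ?_⟩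
      rw [stepProb_succ_two h, he, he', FinTree.prob]

theorem isLUB_stepProb {D : Conf G.Op} (hD : NF D) (hD₀ : ¬ D.IsZero) (j : ℕ) (C : Conf G.Op) :
    IsLUB (Set.range fun k => stepProb s D k j C) (prob (strategyTree s j C) D) := by
  have hP := isLUB_prob (strategyTree s j C) D
  constructor
  · rintro _ ⟨k, rfl⟩
    obtain ⟨R, hR, hS, he⟩ := exists_isFinComp_stepProb_eq hs hD₀ k j C
    exact hP.1 ⟨R, hR, hS, he⟩
  · intro x hx
    refine hP.2 ?_
    rintro _ ⟨R, -, hS, rfl⟩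
    obtain ⟨k, hk⟩ := hS.exists_prob_le hs hD
    exact hk.trans (hx ⟨k, rfl⟩)

end ValidStrategy

/-! ### Final configurations with zero register -/

theorem FinTree.prob_of_isZero {Op : Type u} {D : Conf Op} (hD : D.IsZero) (R : FinTree Op) :
    R.prob D = 0 := by
  induction R with
  | leaf C =>
    rw [FinTree.prob, delta]
    split_ifs with h h' <;> simp_all
  | one C R ih => exact ih
  | two p q C R S ih ih' => simp [FinTree.prob, ih, ih']

theorem prob_of_isZero {D : Conf G.Op} (hD : D.IsZero) (P : Tree G.Op) : prob P D = 0 := by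
  refine (isLUB_prob P D).unique ⟨?_, fun x hx => ?_⟩
  · rintro _ ⟨R, -, -, rfl⟩
    exact (R.prob_of_isZero hD).le
  -- The root alone is a finite sub-computation, so every upper bound is nonnegative.
  · have := hx ⟨.leaf P.root, .leaf _, rfl, rfl⟩
    rwa [FinTree.prob_of_isZero hD] at this

/-! ## Mixed computations -/

/-- A mixed computation is driven by a strategy. -/
theorem IsMaxMixedComp.exists_strategy {M : ℕ → MixedState G.Op} (hM : IsMaxMixedComp M) :
    ∃ s : ℕ → Conf G.Op → Move G.Op, (∀ j C, (s j C).Valid C) ∧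
      ∀ j, (M (j + 1)).weight = ∑ C ∈ (M j).weight.support, M j C • (s j C).weight C := by
  choose N hN hN' using hM
  have h (j : ℕ) (C : Conf G.Op) : ∃ m : Move G.Op, m.Valid C ∧
      (C ∈ (M j).weight.support → (N j C).weight = m.weight C) := by
    by_cases hC : C ∈ (M j).weight.support
    · obtain ⟨m, hm, h⟩ := (hN j C hC).exists_move
      exact ⟨m, hm, fun _ => h⟩
    · obtain ⟨m, hm⟩ := exists_valid_move C
      exact ⟨m, hm, fun h => absurd h hC⟩
  choose s hs hs' using h
  refine ⟨s, hs, fun j => ?_⟩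
  ext D
  rw [hN', Finsupp.finsetSum_apply]
  refine Finset.sum_congr rfl fun C hC => ?_
  rw [← hs' j C hC, Finsupp.smul_apply, smul_eq_mul]

/-! ### Evolution of the mixed states under the strategy -/

section Drive

variable {M : ℕ → MixedState G.Op} {s : ℕ → Conf G.Op → Move G.Op}
  (hM : ∀ j, (M (j + 1)).weight = ∑ C ∈ (M j).weight.support, M j C • (s j C).weight C)

include hM

theorem mixed_eq_sum_stepProb (D : Conf G.Op) (k j : ℕ) :
    M (j + k) D = ∑ C ∈ (M j).weight.support, M j C * stepProb s D k j C := by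
  induction k generalizing j with
  | zero =>
    rw [Finset.sum_eq_single D]
    · simp [stepProb]
    · intro C _ hC
      simp [stepProb, hC]
    · intro hD
      rw [Finsupp.notMem_support_iff.1 hD, zero_mul]
  | succ k ih =>
    have h := ih (j + 1)
    -- Written as a linear form in the weights at time `j + 1`, the sum can be expanded along `hM`
    -- without tracking how the support changes.
    have hl : ∑ C ∈ (M (j + 1)).weight.support, M (j + 1) C * stepProb s D k (j + 1) C =
        Finsupp.linearCombination ℝ (stepProb s D k (j + 1)) (M (j + 1)).weight := rfl
    rw [hl, hM, map_sum, add_right_comm] at h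
    rw [← add_assoc, h]
    refine Finset.sum_congr rfl fun C _ => ?_
    rw [map_smul, smul_eq_mul, stepProb]

/-- Mass at `D` comes from some `C` in the previous support by a move that gives `D` nonzero weight,
and such moves preserve nonzero registers. -/
theorem not_isZero_of_mem_support (hs : ∀ j C, (s j C).Valid C)
    (h₀ : ∀ C ∈ (M 0).weight.support, ¬ C.IsZero) (j : ℕ) :
    ∀ C ∈ (M j).weight.support, ¬ C.IsZero := by
  induction j with
  | zero => exact h₀
  | succ j ih =>
    intro D hD
    rw [Finsupp.mem_support_iff, hM, Finsupp.finsetSum_apply] at hD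
    obtain ⟨C, hC, h⟩ := Finset.exists_ne_zero_of_sum_ne_zero hD
    rw [Finsupp.smul_apply] at h
    exact (hs j C).not_isZero (ih C hC) (right_ne_zero_of_smul h)

end Drive

end

end QStar

theorem mainTheorem3 (G : QStar.GateSet.{u}) (M : ℕ → QStar.MixedState G.Op)
    (hM : QStar.IsMaxMixedComp M) :
    ∃ P : QStar.Conf G.Op → QStar.Tree G.Op,
      (∀ C ∈ (M 0).weight.support, P C ∈ QStar.maxProbComps G ∧ (P C).root = C) ∧
      ∀ D : QStar.Conf G.Op, QStar.NF D →
        (¬ D.IsZero ∨ ∀ C ∈ (M 0).weight.support, ¬ C.IsZero) →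
        IsLUB (Set.range fun j => M j D)
          (∑ C ∈ (M 0).weight.support, M 0 C * QStar.prob (P C) D) := by
  obtain ⟨s, hs, hM⟩ := hM.exists_strategy
  refine ⟨QStar.strategyTree s 0, fun C _ =>
    ⟨QStar.strategyTree_mem_maxProbComps hs 0 C, QStar.root_strategyTree 0 C⟩, fun D hD h => ?_⟩
  by_cases hD₀ : D.IsZero
  · have h₀ : ∀ j, M j D = 0 := fun j => by
      by_contra hj
      exact QStar.not_isZero_of_mem_support hM hs (h.resolve_left (not_not.2 hD₀)) j D
        (Finsupp.mem_support_iff.2 hj) hD₀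
    simp [h₀, QStar.prob_of_isZero hD₀]
  · have hj : ∀ j, M j D =
        ∑ C ∈ (M 0).weight.support, M 0 C * QStar.stepProb s D j 0 C := fun j => by
      rw [← QStar.mixed_eq_sum_stepProb hM, zero_add]
    simp only [hj]
    -- Suprema need not commute with sums, but limits do; monotonicity turns each supremum into a
    -- limit and the limit of the sum back into a supremum.
    refine isLUB_of_tendsto_atTop (fun k l hkl => Finset.sum_le_sum fun C _ =>
      mul_le_mul_of_nonneg_left (QStar.monotone_stepProb hs hD 0 C hkl) ((M 0).mem_Icc C).1) ?_
    exact tendsto_finsetSum _ fun C _ => (tendsto_atTop_isLUB (QStar.monotone_stepProb hs hD 0 C)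
      (QStar.isLUB_stepProb hs hD hD₀ 0 C)).const_mul _
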